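/- Let $q$ be a prime number, let $(k_n)_n$ be integers with $0\le k_n\le n$, and suppose that the rate $R:=\lim_{n\to\infty}\frac{k_n}{n}\log_2 q$ exists. For every $n$ let $\mathbf d_n\in\mathbb F_q^n$ be a fixed vector and let $\mathbf G_n\in\mathbb F_q^{n\times k_n}$ be a random matrix with independent entries, uniformly distributed on $\mathbb F_q$. Put $\mathcal C^{(n)}=\{\mathbf G_n\mathbf m:\mathbf m\in\mathbb F_q^{k_n}\}$ and $\mathcal C'^{(n)}=\{\mathbf t\oplus\mathbf d_n:\mathbf t\in\mathcal C^{(n)}\}$ (with $\oplus$ the addition in $\mathbb F_q^n$), and regard both as subsets of $\{0,\dots,q-1\}^n\subset\mathbb Z^n$. Let $\mathcal C^{(n)}+\mathcal C'^{(n)}=\{\mathbf t+\mathbf v:\mathbf t\in\mathcal C^{(n)},\mathbf v\in\mathcal C'^{(n)}\}\subset\mathbb Z^n$, with addition in $\mathbb Z^n$, and, given $\mathbf G_n$, let $P_{\mathcal S}$ be the distribution of $T_1+T_2$ on it, where $T_1,T_2$ are independent and uniformly distributed on $\mathcal C'^{(n)}$ and $\mathcal C^{(n)}$ respectively. Let $$D(q):=H(U_1+U_2)-\log_2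 q,$$ where $U_1,U_2$ are independent and uniform on $\{0,\dots,q-1\}$, $U_1+U_2$ is their sum in $\mathbb Z$, and $H$ is the entropy in bits. Let $$b:=\begin{cases}2R, & R\le D(q),\\ R+D(q), & R>D(q).\end{cases}$$ Then asymptotically almost surely $\mathcal C^{(n)}$, $\mathcal C'^{(n)}$ have typical sumsets of size $\doteq 2^{nb}$ on which $P_{\mathcal S}\doteq 2^{-nb}$. Precisely: there are deterministic sequences $\epsilon_n\searrow 0$ and $\eta_n\to 0$ such that the probability, over $\mathbf G_n$, that there exists a set $\mathcal K\subseteq\mathcal C^{(n)}+\mathcal C'^{(n)}$ with 1. $P_{\mathcal S}(\mathcal K)\ge 1-\eta_n$, 2. $2^{n(b-\epsilon_n)}\le|\mathcal K|\le 2^{n(b+\epsilon_n)}$, 3. $2^{-n(b+\epsilon_n)}\le P_{\mathcal S}(\mathbf w)\le 2^{-n(b-\epsilon_n)}$ for all $\mathbf w\in\mathcal K$, tends to $1$ as $n\to\infty$. -/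

import Mathlib

open MeasureTheory ProbabilityTheory Filter Topology
open scoped Pointwise

namespace LinearSumset

noncomputable section

/-- The law of `T₁ + T₂`, where `T₁` and `T₂` are independent and uniformly distributed on
`A` and `B` respectively. -/
def sumLaw {α : Type*} [MeasurableSpace α] [Add α] (A B : Set α) : Measure α :=
  ((uniformOn A).prod (uniformOn B)).map (fun p => p.1 + p.2)

/-- The alphabet `{0, …, q - 1}`, as a set of integers. -/
def alphabet (q : ℕ) : Set ℤ := Set.Ico 0 (q : ℤ)

/-- The law `P_W` of `W = U₁ + U₂`, with `U₁, U₂` independent and uniform on `{0, …, q - 1}`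
and the sum taken in `ℤ`. -/
def lawW (q : ℕ) : Measure ℤ := sumLaw (alphabet q) (alphabet q)

/-- The entropy (in bits) of `W`, which takes values in `{0, …, 2q - 2}`. -/
def entropyW (q : ℕ) : ℝ :=
  -∑ a ∈ Finset.Icc (0 : ℤ) (2 * (q : ℤ) - 2),
    (lawW q).real {a} * Real.logb 2 ((lawW q).real {a})

/-- The threshold `D(q) = H(U₁ + U₂) - log₂ q`. -/
def threshold (q : ℕ) : ℝ := entropyW q - Real.logb 2 q

/-- A vector over `ℤ/q`, viewed as an integer vector with entries in `{0, …, q - 1}`. -/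
def intVec {q n : ℕ} (x : Fin n → ZMod q) : Fin n → ℤ := fun i => ((x i).val : ℤ)

/-- The code `{G m : m ∈ F_q^k}` generated by `G`, as a set of integer vectors. -/
def code {q n k : ℕ} (G : Matrix (Fin n) (Fin k) (ZMod q)) : Set (Fin n → ℤ) :=
  intVec '' Set.range (fun m : Fin k → ZMod q => G.mulVec m)

/-- The coset `{G m ⊕ d : m ∈ F_q^k}` of the code generated by `G`, as a set of integer
vectors; the addition of `d` is modulo `q`. -/
def coset {q n k : ℕ} (G : Matrix (Fin n) (Fin k) (ZMod q)) (d : Fin n → ZMod q) :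
    Set (Fin n → ℤ) :=
  intVec '' Set.range (fun m : Fin k → ZMod q => G.mulVec m + d)

/-- The induced distribution `P_S` on `C' + C`: the law of the integer sum of two independent
vectors that are uniform on the coset `C'` and on the code `C`. -/
def inducedLaw {q n k : ℕ} (G : Matrix (Fin n) (Fin k) (ZMod q)) (d : Fin n → ZMod q) :
    Measure (Fin n → ℤ) :=
  sumLaw (coset G d) (code G)

/-- The law of a random `n × k` array with independent entries, each uniform on `ℤ/q`. -/
def generatorLaw (q n k : ℕ) : Measure (Fin n → Fin k → ZMod q) :=
  Measure.pi fun _ => Measure.pi fun _ => uniformOn Set.univ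

/-- `2 ^ (n (b - ε)) ≤ a ≤ 2 ^ (n (b + ε))`. -/
def ExpClose (n : ℕ) (ε a b : ℝ) : Prop :=
  (2 : ℝ) ^ ((n : ℝ) * (b - ε)) ≤ a ∧ a ≤ (2 : ℝ) ^ ((n : ℝ) * (b + ε))

/-- The exponent of the size of a normal typical sumset of a code of rate `R` and its coset. -/
def sumsetExponent (q : ℕ) (R : ℝ) : ℝ :=
  if R ≤ threshold q then 2 * R else R + threshold q

/-- `K` is a subset of the sumset `C + C'` that contains the sum of two independent uniform
codewords with probability at least `1 - η`, whose size is `2 ^ (n b)` up to the factor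
`2 ^ (± n ε)`, and all of whose points have induced probability `2 ^ (- n b)` up to the same
factor; here `b` is `sumsetExponent q R`. -/
structure IsNormalTypical {q n k : ℕ} (R ε η : ℝ) (G : Matrix (Fin n) (Fin k) (ZMod q))
    (d : Fin n → ZMod q) (K : Set (Fin n → ℤ)) : Prop where
  subset : K ⊆ code G + coset G d
  typical : 1 - η ≤ (inducedLaw G d).real K
  size : ExpClose n ε (K.ncard : ℝ) (sumsetExponent q R)
  aep : ∀ w ∈ K, ExpClose n ε ((inducedLaw G d).real {w}) (-sumsetExponent q R)

end

end LinearSumset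

/-! Write `N(a)` for the number of representations of an integer `a` as a sum of two elements of
`{0, …, q - 1}`, `L = log₂ q` and `D` for the threshold. As `P_W(a) = N(a)/q²`, the mean of `log₂
N(W)` is `2L - H(W) = L - D`. By Chebyshev, a sum `w` of two independent uniform vectors therefore
has about `2^(n(L - D))` representations in the full box (`expect_not_typical_le`). Moreover `b =
min(2R, R + D)`.

Fix two linearly independent messages and let `w` be the sum of their words. These words are
independent and uniform, so `w` is typical with high probability. Any message outside their span has
a codeword independent of both, so it is a possible summand of `w` with probability about `2^(-nD)`.
On average there are thus at most about `q² + 2^(n(R - D))` possible summands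
(`expect_typical_boxHits_le`). Up to the size of the kernel, which is bounded in mean, this number
divided by `q^(2k)` bounds the induced mass of `w`, so that mass is at most about `2^(-nb)`.

For the lower bound, every attained sum has mass at least `q^(-2k)`, which suffices when `R ≤ D`.
When `R > D`, sums are counted: there are at most about `2^(n(L + D))` typical ones, and such a sum
is attained only if its residue lies in the coset, which has probability at most about `q^(k - n)`
(the zero message set aside). About `2^(n(R + D))` remain, so those of much smaller mass carry
little in total (`expect_low_le`).

Hence the mean mass of sums outside the window `2^(-n(b ± ε))` tends to zero. Markov's inequality
over the matrix, then a diagonal choice of `ε`, finish the proof. -/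

namespace LinearSumset

noncomputable section

open Finset BigOperators

/-! ### Indicators, diagonal sequences and finite averages -/

/-- The indicator of a proposition, as a real number. -/
def ind (P : Prop) : ℝ := open Classical in if P then 1 else 0

lemma ind_true {P : Prop} (h : P) : ind P = 1 := by simp [ind, h]

lemma ind_false {P : Prop} (h : ¬ P) : ind P = 0 := by simp [ind, h]

lemma ind_nonneg (P : Prop) : 0 ≤ ind P := by unfold ind; split_ifs <;> norm_num

lemma ind_le_one (P : Prop) : ind P ≤ 1 := by unfold ind; split_ifs <;> norm_num

lemma ind_mono {P Q : Prop} (h : P → Q) : ind P ≤ ind Q := by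
  by_cases hP : P
  · rw [ind_true hP, ind_true (h hP)]
  · rw [ind_false hP]; exact ind_nonneg Q

lemma ind_not (P : Prop) : ind (¬ P) = 1 - ind P := by
  by_cases hP : P <;> simp [ind, hP]

lemma ind_le_div {P : Prop} {x a : ℝ} (ha : 0 < a) (hx : 0 ≤ x) (h : P → a ≤ x) :
    ind P ≤ x / a := by
  by_cases hP : P
  · rw [ind_true hP, le_div_iff₀ ha, one_mul]; exact h hP
  · rw [ind_false hP]; positivity

lemma sum_ind {α : Type*} [Fintype α] (P : α → Prop) [DecidablePred P] :
    ∑ a, ind (P a) = ((univ.filter P).card : ℝ) := by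
  rw [← Finset.sum_boole]
  exact Finset.sum_congr rfl fun a _ => by unfold ind; congr

/-- A uniform statement can be diagonalised along an antitone null sequence. -/
lemma exists_antitone_tendsto_zero {Q : ℝ → ℕ → Prop}
    (h : ∀ δ > 0, ∀ᶠ n in atTop, Q δ n) :
    ∃ δ : ℕ → ℝ, Antitone δ ∧ Tendsto δ atTop (𝓝 0) ∧ (∀ n, 0 < δ n) ∧
      ∀ᶠ n in atTop, Q (δ n) n := by
  classical
  have h' : ∀ j : ℕ, ∃ N, ∀ n ≥ N, Q (1 / ((j : ℝ) + 1)) n := fun j =>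
    eventually_atTop.1 (h _ (by positivity))
  choose N hN using h'
  let P : ℕ → ℕ → Prop := fun n j => ∀ i ≤ j, N i ≤ n
  let J : ℕ → ℕ := fun n => Nat.findGreatest (P n) n
  have hJm : Monotone J := fun m n hmn =>
    Nat.findGreatest_mono (fun j hj i hi => (hj i hi).trans hmn) hmn
  have hJt : Tendsto J atTop atTop := by
    refine tendsto_atTop.2 fun j => ?_
    filter_upwards [eventually_ge_atTop (j + ∑ i ∈ range (j + 1), N i)] with n hn
    refine Nat.le_findGreatest (by omega) fun i hi => ?_
    have := Finset.single_le_sum (f := N) (fun _ _ => Nat.zero_le _)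
      (show i ∈ range (j + 1) from Finset.mem_range.2 (Nat.lt_succ_of_le hi))
    omega
  refine ⟨fun n => 1 / ((J n : ℝ) + 1), fun m n hmn => ?_, ?_, fun n => by positivity, ?_⟩
  · have : (J m : ℝ) ≤ J n := by exact_mod_cast hJm hmn
    dsimp only
    gcongr
  · exact tendsto_one_div_add_atTop_nhds_zero_nat.comp hJt
  -- Below `N 0` no index qualifies and `Nat.findGreatest` returns its default value `0`, so nothing
  -- is claimed there.
  · filter_upwards [eventually_ge_atTop (N 0)] with n hn
    have : P n (J n) := Nat.findGreatest_spec (P := P n) (m := 0) (Nat.zero_le _)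
      (fun i hi => by rw [Nat.le_zero.1 hi]; exact hn)
    exact hN _ _ (this _ le_rfl)

/-- The second moment of a sum of centred functions of independent uniform variables. -/
lemma expect_sum_sq {Z : Type*} [Fintype Z] [Nonempty Z] (g : Z → ℝ) (hg : 𝔼 z, g z = 0)
    (n : ℕ) :
    𝔼 z : Fin n → Z, (∑ i, g (z i)) = 0 ∧
      𝔼 z : Fin n → Z, (∑ i, g (z i)) ^ 2 = n * 𝔼 z, g z ^ 2 := by
  induction n with
  | zero => simp
  | succ n ih =>
    obtain ⟨h1, h2⟩ := ih
    have key : ∀ φ : (Fin (n + 1) → Z) → ℝ,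
        𝔼 z, φ z = 𝔼 z : Fin n → Z, 𝔼 a : Z, φ (Fin.cons a z) := by
      intro φ
      rw [Finset.expect_comm, ← Finset.expect_product', univ_product_univ]
      exact (Fintype.expect_equiv (Fin.consEquiv fun _ => Z) _ _ fun i => rfl).symm
    have e : ∀ (a : Z) (z : Fin n → Z),
        ∑ i, g ((Fin.cons a z : Fin (n + 1) → Z) i) = g a + ∑ i, g (z i) := by
      intro a z; simp [Fin.sum_univ_succ]
    constructor
    · simp only [key, e, Finset.expect_add_distrib, Fintype.expect_const, hg, h1, zero_add]
    · have e2 : ∀ (a : Z) (z : Fin n → Z), (g a + ∑ i, g (z i)) ^ 2 =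
          g a ^ 2 + g a * (2 * ∑ i, g (z i)) + (∑ i, g (z i)) ^ 2 := fun a z => by ring
      simp only [key, e, e2, Finset.expect_add_distrib, Fintype.expect_const,
        ← Finset.expect_mul, hg, h2]
      push_cast
      simp
      ring

/-- Chebyshev's inequality for sums of functions of independent uniform variables. -/
lemma expect_ind_deviation_le {Z : Type*} [Fintype Z] [Nonempty Z] (f : Z → ℝ) {μ δ : ℝ}
    (hμ : 𝔼 z, f z = μ) (hδ : 0 < δ) {n : ℕ} (hn : 0 < n) :
    𝔼 z : Fin n → Z, ind (¬ |∑ i, f (z i) - n * μ| ≤ n * δ) ≤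
      (𝔼 z, (f z - μ) ^ 2) / (n * δ ^ 2) := by
  have hn' : (0 : ℝ) < n := by exact_mod_cast hn
  have h := (expect_sum_sq (fun z => f z - μ)
    (by rw [Finset.expect_sub_distrib, Fintype.expect_const, hμ, sub_self]) n).2
  calc _ ≤ 𝔼 z : Fin n → Z, (∑ i, (f (z i) - μ)) ^ 2 / (n * δ) ^ 2 := by
        refine Finset.expect_le_expect fun z _ => ind_le_div (by positivity) (sq_nonneg _) ?_
        intro hz
        rw [Finset.sum_sub_distrib, ← sq_abs (_ - _)]
        simp only [sum_const, card_univ, Fintype.card_fin, nsmul_eq_mul]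
        exact pow_le_pow_left₀ (by positivity) (not_le.1 hz).le 2
    _ = _ := by
        rw [← Finset.expect_div, h]
        field_simp

/-- A surjective homomorphism of finite groups preserves uniform averages. -/
lemma expect_comp_addHom {A B : Type*} [AddGroup A] [AddGroup B] [Fintype A] [Fintype B]
    (φ : A →+ B) (hφ : Function.Surjective φ) (f : B → ℝ) :
    𝔼 a, f (φ a) = 𝔼 b, f b := by
  classical
  have hc : ∀ b, (univ.filter fun a => φ a = b).card = (univ.filter fun a => φ a = 0).card :=
    fun b => AddMonoidHom.card_fiber_eq_of_mem_range φ (hφ b) (hφ 0)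
  have hs : ∀ h : B → ℝ,
      ∑ a, h (φ a) = (univ.filter fun a => φ a = 0).card * ∑ b, h b := by
    intro h
    rw [← Finset.sum_fiberwise (s := univ) (g := φ), Finset.mul_sum]
    refine Finset.sum_congr rfl fun b _ => ?_
    rw [Finset.sum_congr rfl (g := fun _ => h b) (fun a ha => by rw [(mem_filter.1 ha).2]),
      sum_const, hc, nsmul_eq_mul]
  have h1 := hs fun _ => 1
  simp only [sum_const, card_univ, nsmul_eq_mul, mul_one] at h1
  have hA : (Fintype.card A : ℝ) ≠ 0 := by exact_mod_cast Fintype.card_ne_zero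
  have hB : (Fintype.card B : ℝ) ≠ 0 := by exact_mod_cast Fintype.card_ne_zero
  rw [Fintype.expect_eq_sum_div_card, Fintype.expect_eq_sum_div_card, hs, h1,
    mul_div_mul_left]
  intro h0
  rw [h0, zero_mul] at h1
  exact hA h1

/-! ### Uniform laws on codes as averages over messages -/

section

/-- A measure on a finite type with equal point masses is a uniform average. -/
lemma measureReal_eq_expect {V : Type*} [Fintype V] [MeasurableSpace V]
    [MeasurableSingletonClass V] (μ : Measure V) [IsFiniteMeasure μ]
    (h : ∀ x, μ.real {x} = 1 / Fintype.card V) (S : Set V) :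
    μ.real S = 𝔼 x, ind (x ∈ S) := by
  classical
  rw [Fintype.expect_eq_sum_div_card, sum_ind, ← Set.coe_toFinset S,
    ← sum_measureReal_singleton]
  simp only [h, sum_const, nsmul_eq_mul, Set.coe_toFinset, mul_one_div]
  congr 3
  ext; simp

lemma uniformOn_univ_real_singleton {V : Type*} [Fintype V] [MeasurableSpace V]
    [MeasurableSingletonClass V] (x : V) :
    (uniformOn (Set.univ : Set V)).real {x} = 1 / Fintype.card V := by
  simp [measureReal_def, uniformOn_univ]

/-- A map all of whose nonempty fibres have the same size carries the uniform law to the uniform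
law on its range. -/
lemma uniformOn_range {V α : Type*} [Fintype V] [Nonempty V] [MeasurableSpace V]
    [MeasurableSingletonClass V] [MeasurableSpace α] [Countable α] [MeasurableSingletonClass α]
    (f : V → α) [DecidableEq α]
    (hf : ∀ x y, (univ.filter fun z => f z = f x).card = (univ.filter fun z => f z = f y).card) :
    uniformOn (Set.range f) = (uniformOn (Set.univ : Set V)).map f := by
  have hm : Measurable f := measurable_of_finite f
  have : IsProbabilityMeasure (uniformOn (Set.range f)) :=
    isProbabilityMeasure_uniformOn (Set.finite_range f) (Set.range_nonempty f)
  have : IsProbabilityMeasure ((uniformOn (Set.univ : Set V)).map f) :=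
    Measure.isProbabilityMeasure_map hm.aemeasurable
  refine Measure.ext_of_singleton fun a => ?_
  refine (measureReal_eq_measureReal_iff).1 ?_
  rw [map_measureReal_apply hm (measurableSet_singleton a),
    measureReal_eq_expect _ uniformOn_univ_real_singleton, Fintype.expect_eq_sum_div_card]
  simp only [Set.mem_preimage, Set.mem_singleton_iff]
  rw [sum_ind]
  have hr : Set.range f = ((univ.image f : Finset α) : Set α) := by simp
  rw [measureReal_def, hr, ← coe_singleton, uniformOn_apply_finset]
  by_cases ha : a ∈ univ.image f
  · obtain ⟨x, -, rfl⟩ := mem_image.1 ha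
    have hcard : Fintype.card V =
        (univ.image f).card * (univ.filter fun z => f z = f x).card := by
      rw [← card_univ, ← smul_eq_mul, ← sum_const]
      refine (card_eq_sum_card_image f univ).trans ?_
      refine Finset.sum_congr rfl fun b hb => ?_
      obtain ⟨y, -, rfl⟩ := mem_image.1 hb
      exact hf y x
    have h1 : (univ.image f) ∩ {f x} = {f x} := by
      rw [inter_eq_right]; simp
    have h2 : 0 < (univ.filter fun z => f z = f x).card := card_pos.2 ⟨x, by simp⟩
    rw [h1, hcard]
    simp only [card_singleton]
    push_cast
    rw [ENNReal.toReal_div]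
    simp only [ENNReal.toReal_one, ENNReal.toReal_natCast]
    have h3 : ((univ.filter fun z => f z = f x).card : ℝ) ≠ 0 := by exact_mod_cast h2.ne'
    have h4 : ((univ.image f).card : ℝ) ≠ 0 := by
      exact_mod_cast (card_pos.2 ⟨_, ha⟩).ne'
    field_simp
  · have h1 : (univ.image f) ∩ {a} = ∅ := by
      rw [← disjoint_iff_inter_eq_empty]; simpa using ha
    have h2 : (univ.filter fun x => f x = a) = ∅ := by
      ext x
      simp only [mem_filter, mem_univ, true_and, notMem_empty, iff_false]
      rintro rfl
      exact ha (by simp)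
    rw [h1, h2]
    simp

/-- Lets uniform codewords be replaced by uniform messages even when the encoding is not injective.
-/
lemma sumLaw_range_real {V W α : Type*} [Fintype V] [Nonempty V] [Fintype W] [Nonempty W]
    [MeasurableSpace α] [Countable α] [MeasurableSingletonClass α] [Add α] [DecidableEq α]
    (f : V → α) (g : W → α)
    (hf : ∀ x y, (univ.filter fun z => f z = f x).card = (univ.filter fun z => f z = f y).card)
    (hg : ∀ x y, (univ.filter fun z => g z = g x).card = (univ.filter fun z => g z = g y).card)
    (S : Set α) :
    (sumLaw (Set.range f) (Set.range g)).real S = 𝔼 p : V × W, ind (f p.1 + g p.2 ∈ S) := by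
  let _ : MeasurableSpace V := ⊤
  let _ : MeasurableSpace W := ⊤
  have hmf : Measurable f := measurable_of_finite f
  have hmg : Measurable g := measurable_of_finite g
  rw [sumLaw, uniformOn_range f hf, uniformOn_range g hg, Measure.map_prod_map _ _ hmf hmg,
    Measure.map_map (measurable_of_countable _) (hmf.prodMap hmg),
    map_measureReal_apply ((measurable_of_countable _).comp (hmf.prodMap hmg))
      (Set.to_countable S).measurableSet, measureReal_eq_expect]
  · rfl
  · rintro ⟨x, y⟩
    rw [← Set.singleton_prod_singleton, measureReal_prod_prod, uniformOn_univ_real_singleton,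
      uniformOn_univ_real_singleton, Fintype.card_prod]
    push_cast
    rw [div_mul_div_comm, one_mul]

variable {q n k : ℕ}

lemma generatorLaw_real [NeZero q] (S : Set (Fin n → Fin k → ZMod q)) :
    (generatorLaw q n k).real S = 𝔼 g : Fin n → Fin k → ZMod q, ind (g ∈ S) := by
  unfold generatorLaw
  rw [measureReal_eq_expect]
  intro g
  rw [measureReal_def, Measure.pi_singleton]
  simp only [Measure.pi_singleton, ENNReal.toReal_prod, ← measureReal_def,
    uniformOn_univ_real_singleton]
  simp

lemma val_cast_inj [NeZero q] {x y : ZMod q} : (x.val : ℤ) = y.val ↔ x = y := by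
  rw [Nat.cast_inj, (ZMod.val_injective q).eq_iff]

lemma intVec_injective [NeZero q] : Function.Injective (intVec (q := q) (n := n)) := by
  intro x y h
  funext i
  exact val_cast_inj.1 (congrFun h i)

/-- The integer sum of the codeword with message `p.2` and the coset word with message `p.1`. -/
def pairSum (g : Fin n → Fin k → ZMod q) (d : Fin n → ZMod q)
    (p : (Fin k → ZMod q) × (Fin k → ZMod q)) : Fin n → ℤ :=
  intVec ((Matrix.of g).mulVec p.1 + d) + intVec ((Matrix.of g).mulVec p.2)

lemma code_eq_range (g : Fin n → Fin k → ZMod q) :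
    code (Matrix.of g) = Set.range fun m => intVec ((Matrix.of g).mulVec m) := by
  rw [code, ← Set.range_comp]; rfl

lemma coset_eq_range (g : Fin n → Fin k → ZMod q) (d : Fin n → ZMod q) :
    coset (Matrix.of g) d = Set.range fun m => intVec ((Matrix.of g).mulVec m + d) := by
  rw [coset, ← Set.range_comp]; rfl

/-- Nonempty fibres are translates of the kernel. -/
lemma card_fiber_mulVec [NeZero q] (g : Matrix (Fin n) (Fin k) (ZMod q)) (x : Fin k → ZMod q) :
    (univ.filter fun z => g.mulVec z = g.mulVec x).card =
      (univ.filter fun z => g.mulVec z = 0).card := by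
  refine card_bij' (fun z _ => z - x) (fun z _ => z + x) ?_ ?_ ?_ ?_ <;>
    simp +contextual [Matrix.mulVec_sub, Matrix.mulVec_add]

lemma inducedLaw_real [NeZero q] (g : Fin n → Fin k → ZMod q) (d : Fin n → ZMod q)
    (S : Set (Fin n → ℤ)) :
    (inducedLaw (Matrix.of g) d).real S =
      𝔼 p : (Fin k → ZMod q) × (Fin k → ZMod q), ind (pairSum g d p ∈ S) := by
  rw [inducedLaw, code_eq_range, coset_eq_range, sumLaw_range_real]
  · rfl
  · intro x y
    simp only [intVec_injective.eq_iff, add_left_inj, card_fiber_mulVec]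
  · intro x y
    simp only [intVec_injective.eq_iff, card_fiber_mulVec]

lemma mem_sumset_iff (g : Fin n → Fin k → ZMod q) (d : Fin n → ZMod q) (w : Fin n → ℤ) :
    w ∈ code (Matrix.of g) + coset (Matrix.of g) d ↔ ∃ p, pairSum g d p = w := by
  rw [code_eq_range, coset_eq_range, Set.mem_add]
  constructor
  · rintro ⟨_, ⟨a, rfl⟩, _, ⟨b, rfl⟩, rfl⟩
    exact ⟨(b, a), add_comm _ _⟩
  · rintro ⟨p, rfl⟩
    exact ⟨_, ⟨p.2, rfl⟩, _, ⟨p.1, rfl⟩, add_comm _ _⟩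

/-- The number of ways to write `a` as the sum of two elements of `{0, …, q - 1}`. -/
def sumCount (q : ℕ) [NeZero q] (a : ℤ) : ℕ :=
  (univ.filter fun p : ZMod q × ZMod q => (p.1.val : ℤ) + p.2.val = a).card

lemma lawW_real_singleton [NeZero q] (a : ℤ) :
    (lawW q).real {a} = sumCount q a / (q : ℝ) ^ 2 := by
  have hr : alphabet q = Set.range fun x : ZMod q => (x.val : ℤ) := by
    ext z
    simp only [alphabet, Set.mem_Ico, Set.mem_range]
    constructor
    · rintro ⟨h0, h1⟩
      lift z to ℕ using h0
      exact ⟨(z : ZMod q), by rw [ZMod.val_cast_of_lt (by exact_mod_cast h1)]⟩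
    · rintro ⟨x, rfl⟩
      exact ⟨by positivity, by exact_mod_cast ZMod.val_lt x⟩
  have hf : ∀ x : ZMod q, (univ.filter fun z : ZMod q => (z.val : ℤ) = x.val).card = 1 := by
    intro x
    rw [card_eq_one]
    refine ⟨x, ?_⟩
    ext z
    rw [mem_filter, val_cast_inj]
    simp
  rw [lawW, hr, sumLaw_range_real, Fintype.expect_eq_sum_div_card]
  · simp only [Set.mem_singleton_iff]
    rw [sum_ind, Fintype.card_prod, ZMod.card, sumCount]
    push_cast
    rw [sq]
  · intro x y
    exact (hf x).trans (hf y).symm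
  · intro x y
    exact (hf x).trans (hf y).symm

end

/-! ### Independence of the words of a random linear code -/

section

variable {q n k : ℕ} [Fact q.Prime]

/-- A uniform matrix maps linearly independent vectors to independent uniform vectors. -/
lemma expect_mulVec_family {r : ℕ} {v : Fin r → Fin k → ZMod q}
    (hv : LinearIndependent (ZMod q) v) (f : (Fin r → Fin n → ZMod q) → ℝ) :
    𝔼 g : Fin n → Fin k → ZMod q, f (fun j => (Matrix.of g).mulVec (v j)) = 𝔼 t, f t := by
  let φ : (Fin n → Fin k → ZMod q) →+ (Fin r → Fin n → ZMod q) :=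
    { toFun := fun g j => (Matrix.of g).mulVec (v j)
      map_zero' := by funext j; exact Matrix.zero_mulVec _
      map_add' := fun a b => by funext j; exact Matrix.add_mulVec (Matrix.of a) (Matrix.of b) _ }
  refine expect_comp_addHom φ (fun t => ?_) f
  -- Surjectivity: values prescribed on an independent family define a linear map on its span, which
  -- extends to the whole space; the matrix of the extension is the preimage.
  obtain ⟨L, hL⟩ := ((Module.Basis.span hv).constr (ZMod q) t).exists_extend
  refine ⟨LinearMap.toMatrix' L, ?_⟩
  funext j
  change (LinearMap.toMatrix' L).mulVec (v j) = t j
  rw [LinearMap.toMatrix'_mulVec]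
  have h1 : L (v j) = (L ∘ₗ (Submodule.span (ZMod q) (Set.range v)).subtype)
      ((Module.Basis.span hv) j) := by
    simp [Module.Basis.span_apply hv j]
  rw [h1, hL, Module.Basis.constr_basis]

lemma expect_mulVec_one {m : Fin k → ZMod q} (hm : m ≠ 0) (f : (Fin n → ZMod q) → ℝ) :
    𝔼 g : Fin n → Fin k → ZMod q, f ((Matrix.of g).mulVec m) = 𝔼 t, f t := by
  refine (expect_mulVec_family (v := ![m]) (n := n)
    (LinearIndependent.of_subsingleton (0 : Fin 1) hm) (fun t => f (t 0))).trans ?_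
  exact Fintype.expect_equiv (Equiv.funUnique (Fin 1) _) _ _ fun t => rfl

lemma expect_mulVec_two {a b : Fin k → ZMod q} (h : LinearIndependent (ZMod q) ![a, b])
    (f : (Fin n → ZMod q) → (Fin n → ZMod q) → ℝ) :
    𝔼 g : Fin n → Fin k → ZMod q, f ((Matrix.of g).mulVec a) ((Matrix.of g).mulVec b) =
      𝔼 p : (Fin n → ZMod q) × (Fin n → ZMod q), f p.1 p.2 := by
  refine (expect_mulVec_family (n := n) h (fun t => f (t 0) (t 1))).trans ?_
  exact Fintype.expect_equiv (finTwoArrowEquiv _) _ _ fun t => rfl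

lemma expect_mulVec_three {a b c : Fin k → ZMod q}
    (h : LinearIndependent (ZMod q) ![c, a, b])
    (f : (Fin n → ZMod q) → (Fin n → ZMod q) → (Fin n → ZMod q) → ℝ) :
    𝔼 g : Fin n → Fin k → ZMod q, f ((Matrix.of g).mulVec a) ((Matrix.of g).mulVec b)
        ((Matrix.of g).mulVec c) =
      𝔼 p : (Fin n → ZMod q) × (Fin n → ZMod q), 𝔼 t, f p.1 p.2 t := by
  refine (expect_mulVec_family (n := n) h (fun t => f (t 1) (t 2) (t 0))).trans ?_
  rw [Finset.expect_comm, ← Finset.expect_product', univ_product_univ]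
  let e : (Fin 3 → Fin n → ZMod q) ≃
      (Fin n → ZMod q) × ((Fin n → ZMod q) × (Fin n → ZMod q)) :=
    (Fin.consEquiv fun _ => (Fin n → ZMod q)).symm.trans
      (Equiv.prodCongr (Equiv.refl _) (finTwoArrowEquiv _))
  exact Fintype.expect_equiv e _ _ fun t => rfl

lemma expect_shift_two (d : Fin n → ZMod q) (f : (Fin n → ZMod q) → (Fin n → ZMod q) → ℝ) :
    𝔼 p : (Fin n → ZMod q) × (Fin n → ZMod q), f (p.1 + d) p.2 =
      𝔼 p : (Fin n → ZMod q) × (Fin n → ZMod q), f p.1 p.2 :=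
  Fintype.expect_equiv (Equiv.prodCongr (Equiv.addRight d) (Equiv.refl _)) _ _ fun _ => rfl

/-! ### Representation counts and typical sums -/

/-- The number of ways to write `w` as the sum of two vectors with entries in
`{0, …, q - 1}`. -/
def boxCount (q : ℕ) [NeZero q] (w : Fin n → ℤ) : ℕ :=
  (univ.filter fun p : (Fin n → ZMod q) × (Fin n → ZMod q) => intVec p.1 + intVec p.2 = w).card

lemma boxCount_eq_prod (w : Fin n → ℤ) : boxCount q w = ∏ i, sumCount q (w i) := by
  unfold boxCount sumCount
  rw [← Fintype.card_piFinset]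
  refine card_bij' (fun p _ i => (p.1 i, p.2 i)) (fun z _ => (fun i => (z i).1, fun i => (z i).2))
    ?_ ?_ (fun _ _ => rfl) (fun _ _ => rfl)
  · intro p hp
    rw [mem_filter] at hp
    rw [Fintype.mem_piFinset]
    intro i
    rw [mem_filter]
    exact ⟨mem_univ _, congrFun hp.2 i⟩
  · intro z hz
    rw [Fintype.mem_piFinset] at hz
    rw [mem_filter]
    exact ⟨mem_univ _, funext fun i => (mem_filter.1 (hz i)).2⟩

/-- `t` is a possible second summand of `w`. -/
def InBox (w : Fin n → ℤ) (t : Fin n → ZMod q) : Prop :=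
  ∃ x : Fin n → ZMod q, intVec x + intVec t = w

/-- The second summand determines the first, so representations of `w` correspond to possible second
summands. -/
lemma expect_inBox (w : Fin n → ℤ) :
    𝔼 t : Fin n → ZMod q, ind (InBox w t) = boxCount q w / (q : ℝ) ^ n := by
  classical
  rw [Fintype.expect_eq_sum_div_card, sum_ind, Fintype.card_fun, ZMod.card, Fintype.card_fin,
    boxCount]
  push_cast
  congr 2
  symm
  refine card_bij (fun p _ => p.2) ?_ ?_ ?_
  · intro p hp
    simp only [mem_filter, mem_univ, true_and] at hp ⊢
    exact ⟨p.1, hp⟩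
  · rintro ⟨x, t⟩ hp ⟨x', t'⟩ hp' rfl
    simp only [mem_filter, mem_univ, true_and] at hp hp'
    rw [Prod.mk.injEq]
    exact ⟨intVec_injective (add_right_cancel (hp.trans hp'.symm)), rfl⟩
  · intro t ht
    obtain ⟨x, hx⟩ := (mem_filter.1 ht).2
    exact ⟨(x, t), by simpa using hx, rfl⟩

/-- `w` is typical: the number of its representations has exponent close to `μ`. -/
def Typical (q : ℕ) [NeZero q] (μ δ : ℝ) (w : Fin n → ℤ) : Prop :=
  |∑ i, Real.logb 2 (sumCount q (w i)) - n * μ| ≤ n * δ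

lemma sumCount_pos (x y : ZMod q) : 0 < sumCount q ((x.val : ℤ) + y.val) :=
  card_pos.2 ⟨(x, y), by simp⟩

lemma boxCount_eq_rpow (x y : Fin n → ZMod q) :
    (boxCount q (intVec x + intVec y) : ℝ) =
      2 ^ (∑ i, Real.logb 2 (sumCount q ((intVec x + intVec y) i))) := by
  rw [boxCount_eq_prod, Real.rpow_sum_of_pos two_pos]
  push_cast
  refine Finset.prod_congr rfl fun i _ => ?_
  rw [Real.rpow_logb two_pos (by norm_num)]
  exact_mod_cast sumCount_pos (x i) (y i)

lemma Typical.boxCount_le {μ δ : ℝ} {x y : Fin n → ZMod q}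
    (h : Typical q μ δ (intVec x + intVec y)) :
    (boxCount q (intVec x + intVec y) : ℝ) ≤ 2 ^ ((n : ℝ) * (μ + δ)) := by
  rw [boxCount_eq_rpow]
  refine Real.rpow_le_rpow_of_exponent_le one_le_two ?_
  have := (abs_le.1 h).2
  linarith

lemma Typical.le_boxCount {μ δ : ℝ} {x y : Fin n → ZMod q}
    (h : Typical q μ δ (intVec x + intVec y)) :
    2 ^ ((n : ℝ) * (μ - δ)) ≤ (boxCount q (intVec x + intVec y) : ℝ) := by
  rw [boxCount_eq_rpow]
  refine Real.rpow_le_rpow_of_exponent_le one_le_two ?_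
  have := (abs_le.1 h).1
  linarith

/-- The variance of the logarithm of the number of representations of a uniform sum. -/
def logVar (q : ℕ) [NeZero q] (μ : ℝ) : ℝ :=
  𝔼 z : ZMod q × ZMod q, (Real.logb 2 (sumCount q ((z.1.val : ℤ) + z.2.val)) - μ) ^ 2

/-- The two words are independent and uniform, and translation by `d` preserves this; the
coordinates of the pair are then independent and Chebyshev applies. -/
lemma expect_not_typical_le {μ δ : ℝ}
    (hμ : 𝔼 z : ZMod q × ZMod q, Real.logb 2 (sumCount q ((z.1.val : ℤ) + z.2.val)) = μ)
    (hδ : 0 < δ) (hn : 0 < n) (d : Fin n → ZMod q)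
    {p : (Fin k → ZMod q) × (Fin k → ZMod q)} (hp : LinearIndependent (ZMod q) ![p.1, p.2]) :
    𝔼 g : Fin n → Fin k → ZMod q, ind (¬ Typical q μ δ (pairSum g d p)) ≤
      logVar q μ / (n * δ ^ 2) := by
  refine le_of_eq_of_le ?_ (expect_ind_deviation_le _ hμ hδ hn)
  unfold pairSum
  rw [expect_mulVec_two hp (fun x y => ind (¬ Typical q μ δ (intVec (x + d) + intVec y))),
    expect_shift_two d (fun x y => ind (¬ Typical q μ δ (intVec x + intVec y)))]
  exact Fintype.expect_equiv (Equiv.arrowProdEquivProdArrow _ _ _).symm _ _ fun _ => rfl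

/-! ### Upper bound on the induced mass: kernel and possible summands -/

/-- The number of messages that are mapped to zero. -/
def kerCount (g : Fin n → Fin k → ZMod q) : ℝ :=
  ∑ m : Fin k → ZMod q, ind ((Matrix.of g).mulVec m = 0)

lemma kerCount_nonneg (g : Fin n → Fin k → ZMod q) : 0 ≤ kerCount g :=
  Finset.sum_nonneg fun _ _ => ind_nonneg _

lemma expect_ind_eq {V : Type*} [Fintype V] (v : V) :
    𝔼 t : V, ind (t = v) = 1 / Fintype.card V := by
  rw [Fintype.expect_eq_sum_div_card, Finset.sum_eq_single v (fun t _ ht => ind_false ht)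
    (fun h => absurd (mem_univ v) h), ind_true rfl]

lemma expect_ind_mulVec_eq {m : Fin k → ZMod q} (hm : m ≠ 0) (t : Fin n → ZMod q) :
    𝔼 g : Fin n → Fin k → ZMod q, ind ((Matrix.of g).mulVec m = t) = 1 / (q : ℝ) ^ n := by
  rw [expect_mulVec_one hm (fun x => ind (x = t)), expect_ind_eq]
  simp

lemma q_pos_real : (0 : ℝ) < q := by exact_mod_cast (Fact.out : q.Prime).pos

/-- The zero message contributes `1`; each of the fewer than `q ^ k ≤ q ^ n` others contributes `1 /
q ^ n`. -/
lemma expect_kerCount_le (hk : k ≤ n) :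
    𝔼 g : Fin n → Fin k → ZMod q, kerCount g ≤ 2 := by
  have hq := q_pos_real (q := q)
  unfold kerCount
  rw [Finset.expect_sum_comm]
  calc _ ≤ ∑ m : Fin k → ZMod q, (ind (m = 0) + 1 / (q : ℝ) ^ n) := by
        refine Finset.sum_le_sum fun m _ => ?_
        by_cases hm : m = 0
        · rw [ind_true hm]
          refine (Finset.expect_le univ_nonempty fun g _ => ind_le_one _).trans ?_
          have : (0 : ℝ) ≤ 1 / (q : ℝ) ^ n := by positivity
          linarith
        · rw [expect_ind_mulVec_eq hm, ind_false hm, zero_add]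
    _ ≤ 1 + 1 := by
        classical
        rw [Finset.sum_add_distrib, sum_ind]
        simp only [filter_eq', mem_univ, if_true, card_singleton, Nat.cast_one, sum_const,
          card_univ, Fintype.card_fun, ZMod.card, Fintype.card_fin, nsmul_eq_mul, Nat.cast_pow,
          mul_one_div]
        gcongr
        rw [div_le_one (by positivity)]
        exact pow_le_pow_right₀ (by exact_mod_cast (Fact.out : q.Prime).one_lt.le) hk
    _ = 2 := by norm_num

/-- The number of messages whose codeword is a possible summand of `w`. -/
def boxHits (g : Fin n → Fin k → ZMod q) (w : Fin n → ℤ) : ℝ :=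
  ∑ m : Fin k → ZMod q, ind (InBox w ((Matrix.of g).mulVec m))

lemma boxHits_nonneg (g : Fin n → Fin k → ZMod q) (w : Fin n → ℤ) : 0 ≤ boxHits g w :=
  Finset.sum_nonneg fun _ _ => ind_nonneg _

lemma sum_ind_mem_span_pair_le (a b : Fin k → ZMod q) :
    ∑ m : Fin k → ZMod q, ind (m ∈ Submodule.span (ZMod q) (Set.range ![a, b])) ≤
      (q : ℝ) ^ 2 := by
  classical
  rw [sum_ind]
  have h : (univ.filter fun m => m ∈ Submodule.span (ZMod q) (Set.range ![a, b])) ⊆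
      univ.image fun c : ZMod q × ZMod q => c.1 • a + c.2 • b := by
    intro m hm
    have := (mem_filter.1 hm).2
    rw [Matrix.range_cons, Matrix.range_cons, Matrix.range_empty, Set.union_empty,
      Set.singleton_union, Submodule.mem_span_pair] at this
    obtain ⟨x, y, h⟩ := this
    exact mem_image.2 ⟨(x, y), mem_univ _, h⟩
  have h2 := (card_le_card h).trans card_image_le
  rw [card_univ, Fintype.card_prod, ZMod.card, ← sq] at h2
  exact_mod_cast h2

/-- The at most `q ^ 2` messages in the span of the pair are counted trivially. Any other message
has a uniform codeword independent of `w`, which is a possible summand with probability `boxCount q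
w / q ^ n`. -/
lemma expect_typical_boxHits_le {μ δ : ℝ} (d : Fin n → ZMod q)
    {p : (Fin k → ZMod q) × (Fin k → ZMod q)} (hp : LinearIndependent (ZMod q) ![p.1, p.2]) :
    𝔼 g : Fin n → Fin k → ZMod q,
        ind (Typical q μ δ (pairSum g d p)) * boxHits g (pairSum g d p) ≤
      (q : ℝ) ^ 2 + (q : ℝ) ^ k * (2 ^ ((n : ℝ) * (μ + δ)) / (q : ℝ) ^ n) := by
  have hq := q_pos_real (q := q)
  unfold boxHits
  simp_rw [Finset.mul_sum]
  rw [Finset.expect_sum_comm]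
  calc _ ≤ ∑ m : Fin k → ZMod q, (ind (m ∈ Submodule.span (ZMod q) (Set.range ![p.1, p.2])) +
          2 ^ ((n : ℝ) * (μ + δ)) / (q : ℝ) ^ n) := by
        refine Finset.sum_le_sum fun m _ => ?_
        by_cases hm : m ∈ Submodule.span (ZMod q) (Set.range ![p.1, p.2])
        · rw [ind_true hm]
          refine (Finset.expect_le univ_nonempty (a := (1 : ℝ)) fun g _ => ?_).trans ?_
          · exact mul_le_one₀ (ind_le_one _) (ind_nonneg _) (ind_le_one _)
          · have : (0 : ℝ) ≤ 2 ^ ((n : ℝ) * (μ + δ)) / (q : ℝ) ^ n := by positivity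
            linarith
        · have h3 : LinearIndependent (ZMod q) ![m, p.1, p.2] :=
            linearIndependent_finCons.2 ⟨hp, hm⟩
          unfold pairSum
          rw [ind_false hm, zero_add, expect_mulVec_three h3 (fun x y t =>
            ind (Typical q μ δ (intVec (x + d) + intVec y)) *
              ind (InBox (intVec (x + d) + intVec y) t))]
          refine Finset.expect_le univ_nonempty fun r _ => ?_
          rw [← Finset.mul_expect, expect_inBox]
          by_cases ht : Typical q μ δ (intVec (r.1 + d) + intVec r.2)
          · rw [ind_true ht, one_mul]
            gcongr
            exact ht.boxCount_le
          · rw [ind_false ht, zero_mul]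
            positivity
    _ ≤ _ := by
        rw [Finset.sum_add_distrib]
        refine add_le_add (sum_ind_mem_span_pair_le _ _) (le_of_eq ?_)
        simp

/-- A dependent pair has first entry zero or second entry one of `q` multiples of the first. -/
lemma expect_not_linearIndependent_le :
    𝔼 p : (Fin k → ZMod q) × (Fin k → ZMod q),
        ind (¬ LinearIndependent (ZMod q) ![p.1, p.2]) ≤ ((q : ℝ) + 1) / (q : ℝ) ^ k := by
  have hcard : (Fintype.card (Fin k → ZMod q) : ℝ) = (q : ℝ) ^ k := by simp
  calc _ ≤ 𝔼 p : (Fin k → ZMod q) × (Fin k → ZMod q),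
          (∑ c : ZMod q, ind (p.2 = c • p.1) + ind (p.1 = 0)) := by
        refine Finset.expect_le_expect fun p _ => ?_
        by_cases hp : p.1 = 0
        · rw [ind_true hp]
          have := Finset.sum_nonneg (s := univ) fun (c : ZMod q) _ => ind_nonneg (p.2 = c • p.1)
          linarith [ind_le_one (¬ LinearIndependent (ZMod q) ![p.1, p.2])]
        · rw [ind_false hp, add_zero]
          by_cases h : LinearIndependent (ZMod q) ![p.1, p.2]
          · rw [ind_false (not_not.2 h)]
            exact Finset.sum_nonneg fun c _ => ind_nonneg _
          · rw [ind_true h]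
            rw [LinearIndependent.pair_iff' hp] at h
            push Not at h
            obtain ⟨c, hc⟩ := h
            refine le_trans (ind_true hc.symm).symm.le ?_
            exact Finset.single_le_sum (f := fun c : ZMod q => ind (p.2 = c • p.1))
              (fun c _ => ind_nonneg _) (mem_univ c)
    _ = _ := by
        rw [Finset.expect_add_distrib, Finset.expect_sum_comm, add_div, ← univ_product_univ]
        congr 1
        · simp_rw [Finset.expect_product univ univ, expect_ind_eq, Fintype.expect_const]
          rw [sum_const, card_univ, ZMod.card, nsmul_eq_mul, hcard, mul_one_div]
        · rw [Finset.expect_product univ univ]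
          simp_rw [Fintype.expect_const, expect_ind_eq]
          rw [hcard]

/-- The induced probability of a point is at most the normalised number of box hits times the
kernel size. -/
lemma inducedLaw_singleton_le (g : Fin n → Fin k → ZMod q) (d : Fin n → ZMod q)
    (w : Fin n → ℤ) :
    (inducedLaw (Matrix.of g) d).real {w} * (q : ℝ) ^ (2 * k) ≤ kerCount g * boxHits g w := by
  have hq := q_pos_real (q := q)
  have hcard : (Fintype.card ((Fin k → ZMod q) × (Fin k → ZMod q)) : ℝ) = (q : ℝ) ^ (2 * k) := by
    simp [two_mul, pow_add]
  rw [inducedLaw_real, Fintype.expect_eq_sum_div_card, hcard, div_mul_cancel₀ _ (by positivity),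
    Fintype.sum_prod_type_right, boxHits, Finset.mul_sum]
  refine Finset.sum_le_sum fun m' _ => ?_
  -- Once `m'` is fixed, `w` determines the coset word, so the matching `m` form either the empty
  -- set or a translate of the kernel.
  by_cases h : InBox w ((Matrix.of g).mulVec m')
  · rw [ind_true h, mul_one]
    by_cases h0 : ∃ m, pairSum g d (m, m') ∈ ({w} : Set (Fin n → ℤ))
    · obtain ⟨m, hm⟩ := h0
      classical
      rw [kerCount, sum_ind, sum_ind, ← card_fiber_mulVec (Matrix.of g) m]
      refine Nat.cast_le.2 (card_le_card (monotone_filter_right _ fun y _ hy => ?_))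
      rw [Set.mem_singleton_iff] at hm hy
      rw [← hm] at hy
      exact add_right_cancel (intVec_injective (add_right_cancel hy))
    · rw [Finset.sum_eq_zero]
      · exact kerCount_nonneg g
      · intro m _
        exact ind_false fun hm => h0 ⟨m, hm⟩
  · rw [ind_false h, mul_zero]
    refine (Finset.sum_eq_zero fun m _ => ind_false ?_).le
    intro hm
    exact h ⟨_, hm⟩

/-- The pair `p` itself is one of the `q ^ (2 * k)` equally likely pairs. -/
lemma le_inducedLaw_singleton (g : Fin n → Fin k → ZMod q) (d : Fin n → ZMod q)
    (p : (Fin k → ZMod q) × (Fin k → ZMod q)) :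
    1 / (q : ℝ) ^ (2 * k) ≤ (inducedLaw (Matrix.of g) d).real {pairSum g d p} := by
  have hcard : (Fintype.card ((Fin k → ZMod q) × (Fin k → ZMod q)) : ℝ) = (q : ℝ) ^ (2 * k) := by
    simp [two_mul, pow_add]
  rw [inducedLaw_real, Fintype.expect_eq_sum_div_card, hcard]
  gcongr
  refine le_trans (ind_true ?_).symm.le (Finset.single_le_sum
    (f := fun r => ind (pairSum g d r ∈ ({pairSum g d p} : Set (Fin n → ℤ))))
    (fun _ _ => ind_nonneg _) (mem_univ p))
  rfl

/-! ### Lower bound on the induced mass: counting attained typical sums -/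

/-- The typical sums of two vectors with entries in `{0, …, q - 1}`. -/
def typicalSums (q n : ℕ) [Fact q.Prime] (μ δ : ℝ) : Finset (Fin n → ℤ) :=
  open Classical in
  (univ.image fun p : (Fin n → ZMod q) × (Fin n → ZMod q) => intVec p.1 + intVec p.2).filter
    fun w => Typical q μ δ w

lemma mem_typicalSums {μ δ : ℝ} {x y : Fin n → ZMod q}
    (h : Typical q μ δ (intVec x + intVec y)) :
    intVec x + intVec y ∈ typicalSums q n μ δ := by
  classical
  unfold typicalSums
  rw [mem_filter, mem_image]
  exact ⟨⟨(x, y), mem_univ _, rfl⟩, h⟩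

/-- The sets of representations of distinct sums are disjoint sets among `q ^ (2 * n)` pairs, and
those of typical sums are large. -/
lemma card_typicalSums_mul_le (μ δ : ℝ) :
    ((typicalSums q n μ δ).card : ℝ) * 2 ^ ((n : ℝ) * (μ - δ)) ≤ (q : ℝ) ^ (2 * n) := by
  classical
  have h1 : Fintype.card ((Fin n → ZMod q) × (Fin n → ZMod q)) = q ^ (2 * n) := by
    simp [two_mul, pow_add]
  rw [← Nat.cast_pow, ← h1, ← card_univ, card_eq_sum_card_image
    (fun p : (Fin n → ZMod q) × (Fin n → ZMod q) => intVec p.1 + intVec p.2), Nat.cast_sum,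
    ← nsmul_eq_mul]
  refine le_trans ?_ (Finset.sum_le_sum_of_subset_of_nonneg (s := typicalSums q n μ δ)
    (fun w hw => ?_) fun _ _ _ => by positivity)
  · refine Finset.card_nsmul_le_sum _ _ _ fun w hw => ?_
    unfold typicalSums at hw
    rw [mem_filter, mem_image] at hw
    obtain ⟨⟨p, -, rfl⟩, ht⟩ := hw
    exact ht.le_boxCount
  · unfold typicalSums at hw
    exact (mem_filter.1 hw).1

/-- The residue of `w` is the coset word of some nonzero message. -/
def HitsResidue (g : Fin n → Fin k → ZMod q) (d : Fin n → ZMod q) (w : Fin n → ℤ) : Prop :=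
  ∃ s : Fin k → ZMod q, s ≠ 0 ∧ (Matrix.of g).mulVec s = fun i => (w i : ZMod q) - d i

/-- Modulo `q` the sum of the two words is the coset word of `p.1 + p.2`. Here it matters that both
sets are cosets of one linear code: attaining `w` becomes a condition on a single message. -/
lemma hitsResidue_pairSum (g : Fin n → Fin k → ZMod q) (d : Fin n → ZMod q)
    {p : (Fin k → ZMod q) × (Fin k → ZMod q)} (hp : p.1 + p.2 ≠ 0) :
    HitsResidue g d (pairSum g d p) := by
  refine ⟨p.1 + p.2, hp, ?_⟩
  funext i
  simp [pairSum, intVec, Matrix.mulVec_add]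
  ring

/-- Union bound over the nonzero messages, each of which has a uniform codeword. -/
lemma expect_hitsResidue_le (d : Fin n → ZMod q) (w : Fin n → ℤ) :
    𝔼 g : Fin n → Fin k → ZMod q, ind (HitsResidue g d w) ≤ (q : ℝ) ^ k / (q : ℝ) ^ n := by
  have hq := q_pos_real (q := q)
  calc _ ≤ 𝔼 g : Fin n → Fin k → ZMod q, ∑ s : Fin k → ZMod q,
          ind (s ≠ 0 ∧ (Matrix.of g).mulVec s = fun i => (w i : ZMod q) - d i) := by
        refine Finset.expect_le_expect fun g _ => ?_
        by_cases h : HitsResidue g d w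
        · obtain ⟨s, hs⟩ := h
          refine (ind_le_one _).trans ((ind_true hs).symm.le.trans ?_)
          exact Finset.single_le_sum (f := fun s : Fin k → ZMod q =>
            ind (s ≠ 0 ∧ (Matrix.of g).mulVec s = fun i => (w i : ZMod q) - d i))
            (fun _ _ => ind_nonneg _) (mem_univ s)
        · rw [ind_false h]
          exact Finset.sum_nonneg fun _ _ => ind_nonneg _
    _ ≤ ∑ s : Fin k → ZMod q, 1 / (q : ℝ) ^ n := by
        rw [Finset.expect_sum_comm]
        refine Finset.sum_le_sum fun s _ => ?_
        by_cases hs : s = 0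
        · refine (Finset.expect_eq_zero fun g _ => ind_false fun h => h.1 hs).le.trans ?_
          positivity
        · rw [← expect_ind_mulVec_eq hs fun i => (w i : ZMod q) - d i]
          exact Finset.expect_le_expect fun g _ => ind_mono And.right
    _ = _ := by simp [div_eq_mul_inv]

/-- Typical sums with small induced probability carry little mass: there are few of them. -/
lemma expect_low_le (μ δ : ℝ) {lo : ℝ} (hlo : 0 ≤ lo) (d : Fin n → ZMod q) :
    𝔼 g : Fin n → Fin k → ZMod q, 𝔼 p : (Fin k → ZMod q) × (Fin k → ZMod q),
        ind (Typical q μ δ (pairSum g d p) ∧ p.1 + p.2 ≠ 0 ∧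
          (inducedLaw (Matrix.of g) d).real {pairSum g d p} < lo) ≤
      lo * ((q : ℝ) ^ (2 * n) / 2 ^ ((n : ℝ) * (μ - δ))) * ((q : ℝ) ^ k / (q : ℝ) ^ n) := by
  have hq := q_pos_real (q := q)
  have hg : ∀ g : Fin n → Fin k → ZMod q,
      𝔼 p : (Fin k → ZMod q) × (Fin k → ZMod q),
        ind (Typical q μ δ (pairSum g d p) ∧ p.1 + p.2 ≠ 0 ∧
          (inducedLaw (Matrix.of g) d).real {pairSum g d p} < lo) ≤
      ∑ w ∈ typicalSums q n μ δ, lo * ind (HitsResidue g d w) := by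
    intro g
    calc _ ≤ 𝔼 p : (Fin k → ZMod q) × (Fin k → ZMod q), ∑ w ∈ typicalSums q n μ δ,
            ind (pairSum g d p ∈ ({w} : Set (Fin n → ℤ)) ∧ HitsResidue g d w ∧
              (inducedLaw (Matrix.of g) d).real {w} < lo) := by
          refine Finset.expect_le_expect fun p _ => ?_
          by_cases h : Typical q μ δ (pairSum g d p) ∧ p.1 + p.2 ≠ 0 ∧
            (inducedLaw (Matrix.of g) d).real {pairSum g d p} < lo
          · have hP : pairSum g d p ∈ ({pairSum g d p} : Set (Fin n → ℤ)) ∧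
                HitsResidue g d (pairSum g d p) ∧
                (inducedLaw (Matrix.of g) d).real {pairSum g d p} < lo :=
              ⟨rfl, hitsResidue_pairSum g d h.2.1, h.2.2⟩
            refine (ind_le_one _).trans ((ind_true hP).symm.le.trans ?_)
            refine Finset.single_le_sum (f := fun w =>
              ind (pairSum g d p ∈ ({w} : Set (Fin n → ℤ)) ∧ HitsResidue g d w ∧
                (inducedLaw (Matrix.of g) d).real {w} < lo)) (fun _ _ => ind_nonneg _) ?_
            exact mem_typicalSums h.1
          · rw [ind_false h]
            exact Finset.sum_nonneg fun _ _ => ind_nonneg _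
      _ ≤ _ := by
          rw [Finset.expect_sum_comm]
          -- The pairs landing on `w` have total weight equal to its induced mass, which is below
          -- `lo` whenever the term is nonzero.
          refine Finset.sum_le_sum fun w _ => ?_
          by_cases hw : HitsResidue g d w ∧ (inducedLaw (Matrix.of g) d).real {w} < lo
          · rw [ind_true hw.1, mul_one]
            refine le_trans ?_ hw.2.le
            rw [inducedLaw_real]
            exact Finset.expect_le_expect fun p _ => ind_mono And.left
          · refine (Finset.expect_eq_zero fun p _ => ind_false fun h => hw h.2).le.trans ?_
            exact mul_nonneg hlo (ind_nonneg _)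
  calc _ ≤ 𝔼 g : Fin n → Fin k → ZMod q,
          ∑ w ∈ typicalSums q n μ δ, lo * ind (HitsResidue g d w) :=
        Finset.expect_le_expect fun g _ => hg g
    _ ≤ ∑ w ∈ typicalSums q n μ δ, lo * ((q : ℝ) ^ k / (q : ℝ) ^ n) := by
        rw [Finset.expect_sum_comm]
        refine Finset.sum_le_sum fun w _ => ?_
        rw [← Finset.mul_expect]
        exact mul_le_mul_of_nonneg_left (expect_hitsResidue_le d w) hlo
    _ = lo * (typicalSums q n μ δ).card * ((q : ℝ) ^ k / (q : ℝ) ^ n) := by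
        rw [sum_const, nsmul_eq_mul]; ring
    _ ≤ _ := by
        gcongr
        rw [le_div_iff₀ (by positivity)]
        exact card_typicalSums_mul_le μ δ

/-! ### Mean mass of atypical sums -/

/-- The event that the induced probability of the sum of a pair of words is not in `[lo, hi]`. -/
def Atypical (lo hi : ℝ) (g : Fin n → Fin k → ZMod q) (d : Fin n → ZMod q)
    (p : (Fin k → ZMod q) × (Fin k → ZMod q)) : Prop :=
  ¬ (lo ≤ (inducedLaw (Matrix.of g) d).real {pairSum g d p} ∧
    (inducedLaw (Matrix.of g) d).real {pairSum g d p} ≤ hi)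

/-- The event decomposition behind the bound on the mean mass of atypical sums. -/
lemma ind_atypical_le {μ δ lo hi A : ℝ} (hA : 0 < A) (hhi : 0 < hi)
    (g : Fin n → Fin k → ZMod q) (d : Fin n → ZMod q)
    (p : (Fin k → ZMod q) × (Fin k → ZMod q)) :
    ind (Atypical lo hi g d p) ≤
      ind (¬ LinearIndependent (ZMod q) ![p.1, p.2]) +
      ind (LinearIndependent (ZMod q) ![p.1, p.2]) * (ind (¬ Typical q μ δ (pairSum g d p)) +
        ind (Typical q μ δ (pairSum g d p)) * boxHits g (pairSum g d p) /
          (hi * (q : ℝ) ^ (2 * k) / A)) + kerCount g / A +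
      ind (Typical q μ δ (pairSum g d p) ∧ p.1 + p.2 ≠ 0 ∧
          (inducedLaw (Matrix.of g) d).real {pairSum g d p} < lo) := by
  have hq := q_pos_real (q := q)
  have hB : 0 < hi * (q : ℝ) ^ (2 * k) / A := by positivity
  have n1 := div_nonneg (kerCount_nonneg g) hA.le
  have n2 := ind_nonneg (Typical q μ δ (pairSum g d p) ∧ p.1 + p.2 ≠ 0 ∧
          (inducedLaw (Matrix.of g) d).real {pairSum g d p} < lo)
  have n3 := div_nonneg (boxHits_nonneg g (pairSum g d p)) hB.le
  by_cases hL : LinearIndependent (ZMod q) ![p.1, p.2]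
  swap
  · rw [ind_true hL, ind_false hL]
    linarith [ind_le_one (Atypical lo hi g d p)]
  rw [ind_true hL, ind_false (not_not.2 hL)]
  by_cases hT : Typical q μ δ (pairSum g d p)
  swap
  · rw [ind_true hT, ind_false hT, zero_mul, zero_div]
    linarith [ind_le_one (Atypical lo hi g d p)]
  rw [ind_false (not_not.2 hT), ind_true hT, one_mul, zero_add, zero_add, one_mul]
  by_cases hbad : Atypical lo hi g d p
  swap
  · rw [ind_false hbad]
    linarith
  rw [ind_true hbad]
  by_cases hlow : (inducedLaw (Matrix.of g) d).real {pairSum g d p} < lo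
  · have hs : p.1 + p.2 ≠ 0 := by
      intro h
      have := (LinearIndependent.pair_iff.1 hL 1 1 (by simpa using h)).1
      exact one_ne_zero this
    rw [ind_true ⟨hT, hs, hlow⟩]
    linarith
  have hhigh : hi < (inducedLaw (Matrix.of g) d).real {pairSum g d p} := by
    by_contra h
    exact hbad ⟨not_lt.1 hlow, not_lt.1 h⟩
  have hprod : hi * (q : ℝ) ^ (2 * k) ≤ kerCount g * boxHits g (pairSum g d p) :=
    (mul_le_mul_of_nonneg_right hhigh.le (by positivity)).trans (inducedLaw_singleton_le g d _)
  -- Too large a mass forces a large kernel or many possible summands; `A` separates the two causes,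
  -- so that each is bounded by its own mean.
  by_cases hκ : A ≤ kerCount g
  · have : 1 ≤ kerCount g / A := (one_le_div hA).2 hκ
    linarith
  · have h1 : hi * (q : ℝ) ^ (2 * k) ≤ A * boxHits g (pairSum g d p) :=
      hprod.trans (mul_le_mul_of_nonneg_right (not_le.1 hκ).le (boxHits_nonneg _ _))
    have : 1 ≤ boxHits g (pairSum g d p) / (hi * (q : ℝ) ^ (2 * k) / A) := by
      rw [one_le_div hB, div_le_iff₀ hA]
      linarith
    linarith

/-- The mean mass of atypical sums. -/
lemma expect_atypical_le {μ δ lo hi A : ℝ}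
    (hμ : 𝔼 z : ZMod q × ZMod q, Real.logb 2 (sumCount q ((z.1.val : ℤ) + z.2.val)) = μ)
    (hδ : 0 < δ) (hn : 0 < n) (hk : k ≤ n) (hA : 0 < A) (hhi : 0 < hi) (hlo : 0 ≤ lo)
    (d : Fin n → ZMod q) {e : ℝ} (he : 0 ≤ e)
    (hloe : lo ≤ 1 / (q : ℝ) ^ (2 * k) ∨
      lo * ((q : ℝ) ^ (2 * n) / 2 ^ ((n : ℝ) * (μ - δ))) * ((q : ℝ) ^ k / (q : ℝ) ^ n) ≤ e) :
    𝔼 g : Fin n → Fin k → ZMod q, 𝔼 p, ind (Atypical lo hi g d p) ≤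
      ((q : ℝ) + 1) / (q : ℝ) ^ k + (logVar q μ / (n * δ ^ 2) +
        ((q : ℝ) ^ 2 + (q : ℝ) ^ k * (2 ^ ((n : ℝ) * (μ + δ)) / (q : ℝ) ^ n)) /
          (hi * (q : ℝ) ^ (2 * k) / A)) + 2 / A + e := by
  have hq := q_pos_real (q := q)
  have hV : 0 ≤ logVar q μ := Finset.expect_nonneg fun _ _ => sq_nonneg _
  calc _ ≤ 𝔼 g : Fin n → Fin k → ZMod q, 𝔼 p : (Fin k → ZMod q) × (Fin k → ZMod q), _ :=
        Finset.expect_le_expect fun g _ => Finset.expect_le_expect fun p _ =>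
          ind_atypical_le (μ := μ) (δ := δ) hA hhi g d p
    _ ≤ _ := by
        simp only [Finset.expect_add_distrib]
        refine add_le_add (add_le_add (add_le_add ?_ ?_) ?_) ?_
        · rw [Fintype.expect_const]
          exact expect_not_linearIndependent_le
        -- The averages are exchanged so that the pair is fixed and the matrix random.
        · rw [Finset.expect_comm]
          refine Finset.expect_le univ_nonempty fun p _ => ?_
          rw [← Finset.mul_expect, Finset.expect_add_distrib, ← Finset.expect_div]
          by_cases hL : LinearIndependent (ZMod q) ![p.1, p.2]
          · rw [ind_true hL, one_mul]
            refine add_le_add (expect_not_typical_le hμ hδ hn d hL) ?_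
            gcongr
            exact expect_typical_boxHits_le d hL
          · rw [ind_false hL, zero_mul]
            positivity
        · simp only [Fintype.expect_const]
          rw [← Finset.expect_div]
          gcongr
          exact expect_kerCount_le hk
        · rcases hloe with h | h
          · refine le_trans (Finset.expect_eq_zero fun g _ =>
              Finset.expect_eq_zero fun p _ => ind_false ?_).le he
            rintro ⟨-, -, h3⟩
            exact absurd (h.trans (le_inducedLaw_singleton g d p)) (not_le.2 h3)
          · exact (expect_low_le μ δ hlo d).trans h

end

/-! ### Mean logarithm of the representation count and the threshold -/

variable {q : ℕ} [Fact q.Prime]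

lemma val_add_val_mem_Icc (x y : ZMod q) :
    (x.val : ℤ) + y.val ∈ Finset.Icc (0 : ℤ) (2 * (q : ℤ) - 2) := by
  have hx := ZMod.val_lt x
  have hy := ZMod.val_lt y
  rw [Finset.mem_Icc]
  omega

lemma sum_sumCount_mul (f : ℤ → ℝ) :
    ∑ a ∈ Finset.Icc (0 : ℤ) (2 * (q : ℤ) - 2), (sumCount q a : ℝ) * f a =
      ∑ z : ZMod q × ZMod q, f ((z.1.val : ℤ) + z.2.val) := by
  rw [← Finset.sum_fiberwise_of_maps_to (s := univ)
    (g := fun z : ZMod q × ZMod q => (z.1.val : ℤ) + z.2.val)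
    (fun z _ => val_add_val_mem_Icc z.1 z.2)]
  refine Finset.sum_congr rfl fun a _ => ?_
  rw [Finset.sum_congr rfl (g := fun _ => f a) (fun z hz => by rw [(mem_filter.1 hz).2]),
    sum_const, nsmul_eq_mul, sumCount]

/-- The law of `W` gives `a` mass `sumCount q a / q ^ 2`, so `H(W)` is `2 log₂ q` minus this mean.
-/
lemma expect_logb_sumCount :
    𝔼 z : ZMod q × ZMod q, Real.logb 2 (sumCount q ((z.1.val : ℤ) + z.2.val)) =
      Real.logb 2 q - threshold q := by
  have hq := q_pos_real (q := q)
  have h1 := sum_sumCount_mul (q := q) fun a => Real.logb 2 (sumCount q a)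
  have h2 := sum_sumCount_mul (q := q) fun _ => 1
  have h3 : ∀ a : ℤ, (sumCount q a / (q : ℝ) ^ 2) * Real.logb 2 (sumCount q a / (q : ℝ) ^ 2) =
      (sumCount q a * Real.logb 2 (sumCount q a)) / (q : ℝ) ^ 2 -
        (sumCount q a * 1) * (2 * Real.logb 2 q / (q : ℝ) ^ 2) := by
    intro a
    by_cases ha : sumCount q a = 0
    · simp [ha]
    · rw [Real.logb_div (by exact_mod_cast ha) (by positivity), Real.logb_pow]
      push_cast
      ring
  rw [Fintype.expect_eq_sum_div_card, threshold, entropyW]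
  simp only [lawW_real_singleton, h3]
  rw [Finset.sum_sub_distrib, ← Finset.sum_div, ← Finset.sum_mul, h1, h2]
  simp only [sum_const, card_univ, Fintype.card_prod, ZMod.card, nsmul_eq_mul]
  push_cast
  field_simp
  ring

lemma sumCount_le (a : ℤ) : sumCount q a ≤ q := by
  unfold sumCount
  have : (univ : Finset (ZMod q)).card = q := by rw [card_univ, ZMod.card]
  refine le_of_le_of_eq (card_le_card_of_injOn Prod.fst (fun _ _ => mem_univ _) ?_) this
  rintro ⟨x, y⟩ h ⟨x', y'⟩ h' hx
  simp only [coe_filter, mem_univ, true_and, Set.mem_ofPred_eq] at h h' hx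
  subst hx
  rw [Prod.mk.injEq]
  exact ⟨rfl, val_cast_inj.1 (by omega)⟩

/-- No integer has more than `q` representations. This puts `R = 0` in the first case of the
exponent. -/
lemma threshold_nonneg : 0 ≤ threshold q := by
  have h : 𝔼 z : ZMod q × ZMod q, Real.logb 2 (sumCount q ((z.1.val : ℤ) + z.2.val)) ≤
      Real.logb 2 q := by
    refine Finset.expect_le univ_nonempty fun z _ => ?_
    refine Real.logb_le_logb_of_le one_lt_two ?_ ?_
    · exact_mod_cast sumCount_pos z.1 z.2
    · exact_mod_cast sumCount_le _
  rw [expect_logb_sumCount] at h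
  linarith

instance {n k : ℕ} (G : Matrix (Fin n) (Fin k) (ZMod q)) (d : Fin n → ZMod q) :
    IsFiniteMeasure (inducedLaw G d) := by
  unfold inducedLaw sumLaw
  infer_instance

lemma inducedLaw_real_le_one {n k : ℕ} (g : Fin n → Fin k → ZMod q) (d : Fin n → ZMod q)
    (S : Set (Fin n → ℤ)) : (inducedLaw (Matrix.of g) d).real S ≤ 1 := by
  rw [inducedLaw_real]
  exact Finset.expect_le univ_nonempty fun p _ => ind_le_one _

/-! ### From small atypical mass to a typical sumset -/

/-- If the mean mass of the atypical sums is small, then the remaining sums form a normal typical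
sumset. -/
lemma exists_isNormalTypical {n k : ℕ} {R ε η : ℝ} (hε : 0 ≤ ε)
    (g : Fin n → Fin k → ZMod q) (d : Fin n → ZMod q)
    (h : 𝔼 p, ind (Atypical (2 ^ ((n : ℝ) * (-sumsetExponent q R - ε)))
      (2 ^ ((n : ℝ) * (-sumsetExponent q R + ε))) g d p) ≤ η)
    (hη : 2 ^ (-((n : ℝ) * ε)) ≤ 1 - η) :
    ∃ K, IsNormalTypical R (2 * ε) η (Matrix.of g) d K := by
  classical
  have hnε : 0 ≤ (n : ℝ) * ε := by positivity
  set b := sumsetExponent q R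
  set μ := inducedLaw (Matrix.of g) d
  set lo : ℝ := 2 ^ ((n : ℝ) * (-b - ε))
  set hi : ℝ := 2 ^ ((n : ℝ) * (-b + ε))
  let K : Set (Fin n → ℤ) := {w | (∃ p, pairSum g d p = w) ∧ lo ≤ μ.real {w} ∧ μ.real {w} ≤ hi}
  have hKfin : K.Finite := (Set.finite_range (pairSum g d)).subset fun w hw => hw.1
  have hK : 1 - η ≤ μ.real K := by
    rw [inducedLaw_real]
    have : ∀ p, ind (pairSum g d p ∈ K) = 1 - ind (Atypical lo hi g d p) := by
      intro p
      rw [← ind_not]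
      congr 1
      simp only [K, Atypical, not_not, Set.mem_ofPred_eq, exists_apply_eq_apply, true_and]
      rfl
    simp_rw [this]
    rw [Finset.expect_sub_distrib, Fintype.expect_const]
    linarith
  have hsum : μ.real K = ∑ w ∈ hKfin.toFinset, μ.real {w} := by
    rw [sum_measureReal_singleton, Set.Finite.coe_toFinset]
  have hcard : K.ncard = hKfin.toFinset.card := Set.ncard_eq_toFinset_card K hKfin
  refine ⟨K, fun w hw => (mem_sumset_iff g d w).2 hw.1, hK, ⟨?_, ?_⟩, fun w hw => ⟨?_, ?_⟩⟩
  -- The size follows from comparing total mass with the extreme point masses. The loss `1 - η ≥ 2 ^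
  -- (-(n ε))` in total mass is what doubles the tolerance.
  · have h1 : μ.real K ≤ K.ncard * hi := by
      rw [hsum, hcard, ← nsmul_eq_mul]
      exact Finset.sum_le_card_nsmul _ _ _ fun w hw => (hKfin.mem_toFinset.1 hw).2.2
    have h2 : (2 : ℝ) ^ ((n : ℝ) * (b - 2 * ε)) * hi = 2 ^ (-((n : ℝ) * ε)) := by
      rw [← Real.rpow_add two_pos]
      congr 1
      ring
    exact le_of_mul_le_mul_right (h2.le.trans (hη.trans (hK.trans h1)))
      (Real.rpow_pos_of_pos two_pos _)
  · have h1 : K.ncard * lo ≤ μ.real K := by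
      rw [hsum, hcard, ← nsmul_eq_mul]
      exact Finset.card_nsmul_le_sum _ _ _ fun w hw => (hKfin.mem_toFinset.1 hw).2.1
    have h2 : 1 ≤ (2 : ℝ) ^ ((n : ℝ) * (b + 2 * ε)) * lo := by
      rw [← Real.rpow_add two_pos]
      exact Real.one_le_rpow one_le_two (by nlinarith)
    exact le_of_mul_le_mul_right ((h1.trans (inducedLaw_real_le_one g d K)).trans h2)
      (Real.rpow_pos_of_pos two_pos _)
  · exact le_trans (Real.rpow_le_rpow_of_exponent_le one_le_two (by nlinarith)) hw.2.1
  · exact hw.2.2.trans (Real.rpow_le_rpow_of_exponent_le one_le_two (by nlinarith))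

/-! ### Exponents and limits -/

lemma pow_card_eq_rpow {n k : ℕ} (hn : 0 < n) :
    (q : ℝ) ^ k = 2 ^ ((n : ℝ) * ((k : ℝ) / n * Real.logb 2 q)) := by
  have hn' : (n : ℝ) ≠ 0 := by exact_mod_cast hn.ne'
  have : (n : ℝ) * ((k : ℝ) / n * Real.logb 2 q) = Real.logb 2 q * k := by field_simp
  rw [this, Real.rpow_mul two_pos.le, Real.rpow_logb two_pos (by norm_num) q_pos_real,
    Real.rpow_natCast]

lemma pow_two_mul_eq_rpow {n k : ℕ} (hn : 0 < n) :
    (q : ℝ) ^ (2 * k) = 2 ^ ((n : ℝ) * (2 * ((k : ℝ) / n * Real.logb 2 q))) := by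
  rw [mul_comm 2 k, pow_mul, pow_card_eq_rpow hn, ← Real.rpow_natCast, ← Real.rpow_mul two_pos.le]
  congr 1
  push_cast
  ring

lemma tendsto_two_rpow_neg_mul {c : ℝ} (hc : 0 < c) :
    Tendsto (fun n : ℕ => (2 : ℝ) ^ (-((n : ℝ) * c))) atTop (𝓝 0) := by
  have h : ∀ n : ℕ, (2 : ℝ) ^ (-((n : ℝ) * c)) = ((2 : ℝ) ^ (-c)) ^ n := by
    intro n
    rw [← Real.rpow_natCast, ← Real.rpow_mul two_pos.le]
    congr 1
    ring
  simp_rw [h]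
  exact tendsto_pow_atTop_nhds_zero_of_lt_one (by positivity)
    (Real.rpow_lt_one_of_one_lt_of_neg one_lt_two (by linarith))

/-- The bound on the mean mass of atypical sums when the rate of the code is close to `R`. -/
lemma expect_atypical_le_of_rate {n k : ℕ} {R δ : ℝ} (hn : 0 < n) (hk : k ≤ n) (hδ : 0 < δ)
    (hρ : |(k : ℝ) / n * Real.logb 2 q - R| ≤ min δ (R / 2))
    (d : Fin n → ZMod q) :
    𝔼 g : Fin n → Fin k → ZMod q, 𝔼 p, ind (Atypical
        (2 ^ ((n : ℝ) * (-sumsetExponent q R - 6 * δ)))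
        (2 ^ ((n : ℝ) * (-sumsetExponent q R + 6 * δ))) g d p) ≤
      ((q : ℝ) + 1) * 2 ^ (-((n : ℝ) * (R / 2))) +
        logVar q (Real.logb 2 q - threshold q) / δ ^ 2 * (1 / n) +
        ((q : ℝ) ^ 2 + 4) * 2 ^ (-((n : ℝ) * δ)) := by
  have hq := q_pos_real (q := q)
  have hn' : (0 : ℝ) < n := by exact_mod_cast hn
  set ρ := (k : ℝ) / n * Real.logb 2 q
  set L := Real.logb 2 (q : ℝ)
  set D := threshold q
  set b := sumsetExponent q R with hb
  have hρ1 := (abs_le.1 (hρ.trans (min_le_left _ _)))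
  have hρ2 := (abs_le.1 (hρ.trans (min_le_right _ _)))
  have hqk : (q : ℝ) ^ k = 2 ^ ((n : ℝ) * ρ) := pow_card_eq_rpow hn
  have hqn : (q : ℝ) ^ n = 2 ^ ((n : ℝ) * L) := by
    rw [pow_card_eq_rpow hn, div_self hn'.ne', one_mul]
  have hq2k : (q : ℝ) ^ (2 * k) = 2 ^ ((n : ℝ) * (2 * ρ)) := pow_two_mul_eq_rpow hn
  have hq2n : (q : ℝ) ^ (2 * n) = 2 ^ ((n : ℝ) * (2 * L)) := by
    rw [pow_two_mul_eq_rpow hn, div_self hn'.ne', one_mul]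
  have mono : ∀ {x y : ℝ}, x ≤ y → (2 : ℝ) ^ ((n : ℝ) * x) ≤ 2 ^ ((n : ℝ) * y) := fun h =>
    Real.rpow_le_rpow_of_exponent_le one_le_two (mul_le_mul_of_nonneg_left h hn'.le)
  have neg : ∀ x : ℝ, -((n : ℝ) * x) = n * (-x) := fun x => (mul_neg _ _).symm
  -- The upper bound on masses needs both inequalities `b ≤ 2R` and `b ≤ R + D`; the lower bound
  -- below uses equality in one of them.
  have hc1 : b ≤ 2 * R := by
    rw [hb, sumsetExponent]; split_ifs <;> linarith
  have hc2 : b ≤ R + D := by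
    rw [hb, sumsetExponent]; split_ifs <;> linarith
  -- The margin `6 * δ` is generous: it pays for typicality, for the kernel cutoff `A`, for the rate
  -- error (at most `2 * δ` in `2ρ`) and leaves a decaying factor `2 ^ (-(n δ))`.
  have key := expect_atypical_le (k := k) (lo := 2 ^ ((n : ℝ) * (-b - 6 * δ)))
    (hi := 2 ^ ((n : ℝ) * (-b + 6 * δ))) (A := 2 ^ ((n : ℝ) * δ))
    (e := 2 ^ (-((n : ℝ) * δ))) expect_logb_sumCount hδ hn hk (by positivity) (by positivity)
    (by positivity) d (by positivity) (by
      rw [hq2k, hq2n, hqk, hqn, one_div, ← Real.rpow_neg two_pos.le, ← Real.rpow_sub two_pos,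
        ← Real.rpow_sub two_pos, ← Real.rpow_add two_pos, ← Real.rpow_add two_pos, neg, neg]
      by_cases hRD : R ≤ D
      · left
        have : b = 2 * R := by rw [hb, sumsetExponent, if_pos hRD]
        exact mono (by linarith)
      · right
        have : b = R + D := by rw [hb, sumsetExponent, if_neg hRD]
        rw [← mul_sub, ← mul_sub, ← mul_add, ← mul_add]
        exact mono (by linarith))
  refine key.trans ?_
  have t1 : ((q : ℝ) + 1) / (q : ℝ) ^ k ≤ ((q : ℝ) + 1) * 2 ^ (-((n : ℝ) * (R / 2))) := by
    rw [div_eq_mul_inv, hqk, ← Real.rpow_neg two_pos.le, neg, neg]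
    exact mul_le_mul_of_nonneg_left (mono (by linarith)) (by positivity)
  have t2 : logVar q (L - D) / (n * δ ^ 2) = logVar q (L - D) / δ ^ 2 * (1 / n) := by
    field_simp
  have t3 : ((q : ℝ) ^ 2 + (q : ℝ) ^ k * (2 ^ ((n : ℝ) * (L - D + δ)) / (q : ℝ) ^ n)) /
      (2 ^ ((n : ℝ) * (-b + 6 * δ)) * (q : ℝ) ^ (2 * k) / 2 ^ ((n : ℝ) * δ)) ≤
      ((q : ℝ) ^ 2 + 1) * 2 ^ (-((n : ℝ) * δ)) := by
    rw [div_le_iff₀ (by positivity), hq2k, hqk, hqn, ← Real.rpow_sub two_pos,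
      ← Real.rpow_add two_pos, ← Real.rpow_add two_pos, ← Real.rpow_sub two_pos, mul_assoc,
      ← Real.rpow_add two_pos, neg, ← mul_sub, ← mul_add, ← mul_add, ← mul_sub, ← mul_add, add_mul,
      one_mul]
    refine add_le_add ?_ (mono (by linarith))
    refine le_mul_of_one_le_right (by positivity) (Real.one_le_rpow one_le_two ?_)
    exact mul_nonneg hn'.le (by linarith)
  have t4 : 2 / (2 : ℝ) ^ ((n : ℝ) * δ) = 2 * 2 ^ (-((n : ℝ) * δ)) := by
    rw [Real.rpow_neg two_pos.le, div_eq_mul_inv]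
  rw [t2, t4]
  linarith

/-- The mean mass of atypical sums tends to zero. -/
lemma tendsto_expect_atypical {k : ℕ → ℕ} (hk : ∀ n, k n ≤ n) {R : ℝ}
    (hR : Tendsto (fun n : ℕ => (k n : ℝ) / (n : ℝ) * Real.logb 2 (q : ℝ)) atTop (𝓝 R))
    (d : ∀ n, Fin n → ZMod q) {ε : ℝ} (hε : 0 < ε) :
    Tendsto (fun n : ℕ => 𝔼 g : Fin n → Fin (k n) → ZMod q, 𝔼 p, ind (Atypical
      (2 ^ ((n : ℝ) * (-sumsetExponent q R - ε)))
      (2 ^ ((n : ℝ) * (-sumsetExponent q R + ε))) g (d n) p)) atTop (𝓝 0) := by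
  have hL : 0 ≤ Real.logb 2 (q : ℝ) := Real.logb_nonneg one_lt_two
    (by exact_mod_cast (Fact.out : q.Prime).one_lt.le)
  have hR0 : 0 ≤ R := ge_of_tendsto' hR fun n => by positivity
  -- At `R = 0` dependent pairs of messages need not be rare, but then `b = 0` and every attained
  -- sum has mass between `q ^ (-2k) ≥ 2 ^ (-(n ε))` and `1`, eventually.
  rcases hR0.eq_or_lt with rfl | hRpos
  · refine Tendsto.congr' ?_ tendsto_const_nhds
    filter_upwards [eventually_gt_atTop 0, hR.eventually_le_const (half_pos hε)] with n hn hρ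
    symm
    refine Finset.expect_eq_zero fun g _ => Finset.expect_eq_zero fun p _ =>
      ind_false (not_not.2 ?_)
    have hb : sumsetExponent q 0 = 0 := by
      rw [sumsetExponent, if_pos threshold_nonneg, mul_zero]
    rw [hb]
    have hn' : (0 : ℝ) < n := by exact_mod_cast hn
    constructor
    · refine le_trans ?_ (le_inducedLaw_singleton g (d n) p)
      rw [pow_two_mul_eq_rpow hn, one_div, ← Real.rpow_neg two_pos.le]
      refine Real.rpow_le_rpow_of_exponent_le one_le_two ?_
      rw [← mul_neg]
      exact mul_le_mul_of_nonneg_left (by linarith) hn'.le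
    · refine (inducedLaw_real_le_one _ _ _).trans (Real.one_le_rpow one_le_two ?_)
      nlinarith
  · have hδ : 0 < ε / 6 := by positivity
    -- The bound `R / 2` keeps the rate at least `R / 2`, so that `q ^ (-k)` decays exponentially.
    have hev := (Metric.tendsto_nhds.1 hR) (min (ε / 6) (R / 2)) (by positivity)
    have hlim : Tendsto (fun n : ℕ => ((q : ℝ) + 1) * 2 ^ (-((n : ℝ) * (R / 2))) +
        logVar q (Real.logb 2 q - threshold q) / (ε / 6) ^ 2 * (1 / (n : ℝ)) +
        ((q : ℝ) ^ 2 + 4) * 2 ^ (-((n : ℝ) * (ε / 6)))) atTop (𝓝 0) := by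
      have := (((tendsto_two_rpow_neg_mul (half_pos hRpos)).const_mul ((q : ℝ) + 1)).add
        (tendsto_one_div_atTop_nhds_zero_nat.const_mul
          (logVar q (Real.logb 2 q - threshold q) / (ε / 6) ^ 2))).add
        ((tendsto_two_rpow_neg_mul hδ).const_mul ((q : ℝ) ^ 2 + 4))
      simpa using this
    refine squeeze_zero' (Eventually.of_forall fun n => Finset.expect_nonneg fun g _ =>
      Finset.expect_nonneg fun p _ => ind_nonneg _) ?_ hlim
    filter_upwards [eventually_gt_atTop 0, hev] with n hn hρ
    have := expect_atypical_le_of_rate hn (hk n) hδ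
      (by rw [Real.dist_eq] at hρ; exact hρ.le) (d n)
    rwa [mul_div_cancel₀ ε (by norm_num : (6 : ℝ) ≠ 0)] at this

/-- For a fixed tolerance, almost all codes have a normal typical sumset. -/
lemma eventually_le_generatorLaw {k : ℕ → ℕ} (hk : ∀ n, k n ≤ n) {R : ℝ}
    (hR : Tendsto (fun n : ℕ => (k n : ℝ) / (n : ℝ) * Real.logb 2 (q : ℝ)) atTop (𝓝 R))
    (d : ∀ n, Fin n → ZMod q) {δ : ℝ} (hδ : 0 < δ) :
    ∀ᶠ n in atTop, 1 - δ ≤ (generatorLaw q n (k n)).real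
      {g | ∃ K, IsNormalTypical R δ δ (Matrix.of g) (d n) K} := by
  have hε : 0 < δ / 2 := by positivity
  -- The cap `1 / 2` keeps `1 - η` above `2 ^ (-(n δ / 2))` eventually. A mean of at most `η * δ`
  -- then gives, by Markov, mass above `η` with probability at most `δ`.
  set η := min δ (1 / 2)
  have hη : 0 < η := by positivity
  filter_upwards [(tendsto_expect_atypical hk hR d hε).eventually_le_const
      (show 0 < η * δ by positivity),
    (tendsto_two_rpow_neg_mul hε).eventually_le_const (show (0 : ℝ) < 1 / 2 by norm_num)]
    with n h1 h2
  rw [generatorLaw_real]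
  have h3 : ∀ g : Fin n → Fin (k n) → ZMod q,
      1 - (𝔼 p, ind (Atypical (2 ^ ((n : ℝ) * (-sumsetExponent q R - δ / 2)))
        (2 ^ ((n : ℝ) * (-sumsetExponent q R + δ / 2))) g (d n) p)) / η ≤
      ind (g ∈ {g | ∃ K, IsNormalTypical R δ δ (Matrix.of g) (d n) K}) := by
    intro g
    by_cases hg : 𝔼 p, ind (Atypical (2 ^ ((n : ℝ) * (-sumsetExponent q R - δ / 2)))
        (2 ^ ((n : ℝ) * (-sumsetExponent q R + δ / 2))) g (d n) p) ≤ η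
    · obtain ⟨K, hK⟩ := exists_isNormalTypical hε.le g (d n) hg
        (h2.trans (by linarith [min_le_right δ (1 / 2)]))
      rw [mul_div_cancel₀ δ (by norm_num : (2 : ℝ) ≠ 0)] at hK
      have hmem : g ∈ {g | ∃ K, IsNormalTypical R δ δ (Matrix.of g) (d n) K} :=
        ⟨K, hK.subset, le_trans (by linarith [min_le_left δ (1 / 2)]) hK.typical, hK.size, hK.aep⟩
      rw [ind_true hmem, sub_le_self_iff]
      exact div_nonneg (Finset.expect_nonneg fun p _ => ind_nonneg _) hη.le
    · have := (one_le_div hη).2 (not_le.1 hg).le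
      linarith [ind_nonneg (g ∈ {g | ∃ K, IsNormalTypical R δ δ (Matrix.of g) (d n) K})]
  refine le_trans ?_ (Finset.expect_le_expect fun g _ => h3 g)
  rw [Finset.expect_sub_distrib, Fintype.expect_const, ← Finset.expect_div]
  have : (𝔼 g : Fin n → Fin (k n) → ZMod q,
      𝔼 p, ind (Atypical (2 ^ ((n : ℝ) * (-sumsetExponent q R - δ / 2)))
        (2 ^ ((n : ℝ) * (-sumsetExponent q R + δ / 2))) g (d n) p)) / η ≤ δ := by
    rw [div_le_iff₀ hη]
    linarith
  linarith

end

end LinearSumset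

theorem corollary1 (q : ℕ) [Fact q.Prime] (k : ℕ → ℕ) (hk : ∀ n, k n ≤ n) (R : ℝ)
    (hR : Tendsto (fun n : ℕ => (k n : ℝ) / (n : ℝ) * Real.logb 2 (q : ℝ)) atTop (𝓝 R))
    (d : ∀ n, Fin n → ZMod q) :
    ∃ ε η : ℕ → ℝ, Antitone ε ∧ Tendsto ε atTop (𝓝 0) ∧ Tendsto η atTop (𝓝 0) ∧
      Tendsto
        (fun n : ℕ => (LinearSumset.generatorLaw q n (k n)).real
          {g | ∃ K : Set (Fin n → ℤ),
            LinearSumset.IsNormalTypical R (ε n) (η n) (Matrix.of g) (d n) K})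
        atTop (𝓝 1) := by
  -- One diagonal sequence serves as `ε`, as `η` and as the bound on the failure probability.
  obtain ⟨δ, hanti, hlim, -, hev⟩ := LinearSumset.exists_antitone_tendsto_zero
    fun δ hδ => LinearSumset.eventually_le_generatorLaw hk hR d (δ := δ) hδ
  refine ⟨δ, δ, hanti, hlim, hlim, ?_⟩
  refine tendsto_of_tendsto_of_tendsto_of_le_of_le' (by simpa using hlim.const_sub 1)
    tendsto_const_nhds hev (Eventually.of_forall fun n => ?_)
  rw [LinearSumset.generatorLaw_real]
  exact Finset.expect_le Finset.univ_nonempty fun g _ => LinearSumset.ind_le_one _
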